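/- Conventions. A compactum is a compact Hausdorff space. For a topological space $X$, a set $K\subset X$ and a map $d$ into $\mathbb{R}$ defined on pairs of points of $K$, we say that $d$ fragments $K$ if for every $\varepsilon>0$ every nonempty $L\subset K$ has a nonempty relatively open subset $U$ with $\sup\{d(x,y):x,y\in U\}<\varepsilon$. A Radon–Nikodým (RN) compactum is a compactum $L$ for which there is a metric $d:L\times L\to\mathbb{R}$, lower semicontinuous on $L\times L$, that fragments $L$. For $s\in\mathbb{N}^{<\omega}$ (a finite sequence of natural numbers), $\mathcal{N}_s$ is the set of all $\sigma\in\mathbb{N}^{\mathbb{N}}$ that have $s$ as an initial segment. For $\Delta\subset\Gamma$ and $x,y\in[a,b]^\Gamma$ put $d_\Delta(x,y)=\sup\{|x_\gamma-y_\gamma|:\gamma\in\Delta\}$ (which is $0$ if $\Delta=\emptyset$); cubes carry the product topology. Theorem. Let $\Gamma$ be a set and let $K\subset[a,b]^\Gamma$ be compact. The following are equivalent. (1) $K$ is the continuous image of an RN compactum. (2) There exist a map $u:\Gamma\to\mathbb{N}^{\mathbb{N}}$ and compact sets $K_s\subset[a,b]^\Gamma$ ($s\in\mathbb{N}^{<\omega}$)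 such that (a) $d_{u^{-1}(\mathcal{N}_s)}$ fragments $K_s$ for every $s$, and (b) if $\mathrm{length}(s)=n>0$, then for every $x\in K$ there is $y\in K_s$ with $d_{u^{-1}(\mathcal{N}_s)}(x,y)\le 2^{-n}$. (3) For every $\varepsilon>0$ there exist a countable decomposition $\Gamma=\bigcup_{m\in\mathbb{N}}\Gamma_m$ (the sets $\Gamma_m$ may overlap or be empty) and compact sets $K_m\subset[a,b]^\Gamma$ ($m\in\mathbb{N}$) such that (a) $d_{\Gamma_m}$ fragments $K_m$ for every $m$, and (b) for every $m$ and every $x\in K$ there is $y\in K_m$ with $d_{\Gamma_m}(x,y)\le\varepsilon$. -/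

import Mathlib

universe u v

/-- `d` `ε`-fragments the subset `K` of the topological space `X`: every nonempty `L ⊆ K` has a
nonempty relatively open subset `V ∩ L` with `sup {d x y : x, y ∈ V ∩ L} < ε`. (The supremum
being `< ε` means that some `δ < ε` is an upper bound, as `V ∩ L` is nonempty.) -/
def EpsFragments {X : Type u} [TopologicalSpace X] (d : X → X → ℝ) (ε : ℝ) (K : Set X) : Prop :=
  ∀ L : Set X, L ⊆ K → L.Nonempty →
    ∃ V : Set X, IsOpen V ∧ (V ∩ L).Nonempty ∧
      ∃ δ : ℝ, δ < ε ∧ ∀ x ∈ V ∩ L, ∀ y ∈ V ∩ L, d x y ≤ δ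

/-- `d` fragments `K` if it `ε`-fragments `K` for every `ε > 0`. -/
def Fragments {X : Type u} [TopologicalSpace X] (d : X → X → ℝ) (K : Set X) : Prop :=
  ∀ ε : ℝ, 0 < ε → EpsFragments d ε K

/-- `d` is a metric on the set `X` (nonnegativity follows from the three axioms). It need not have
anything to do with a topology that `X` carries. -/
structure IsMetric {X : Type u} (d : X → X → ℝ) : Prop where
  eq_zero_iff : ∀ x y, d x y = 0 ↔ x = y
  symm : ∀ x y, d x y = d y x
  triangle : ∀ x y z, d x z ≤ d x y + d y z

/-- A Radon–Nikodým compactum: a compact Hausdorff space that is fragmented by some metric which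
is lower semicontinuous on the square of the space. -/
structure IsRNCompact (L : Type u) [TopologicalSpace L] : Prop where
  compact : CompactSpace L
  t2 : T2Space L
  exists_metric : ∃ d : L → L → ℝ, IsMetric d ∧
    LowerSemicontinuous (fun p : L × L => d p.1 p.2) ∧ Fragments d Set.univ

/-- `K` is a continuous image of a Radon–Nikodým compactum. The compactum may live in an
arbitrarily large universe. -/
def IsContinuousImageOfRN {X : Type u} [TopologicalSpace X] (K : Set X) : Prop :=
  ∃ (L : Type (max u v)) (_ : TopologicalSpace L) (f : L → X),
    IsRNCompact L ∧ Continuous f ∧ Set.range f = K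

/-- The cube `[a,b]^Γ` in `ℝ^Γ` (which carries the product topology). -/
def cube (Γ : Type u) (a b : ℝ) : Set (Γ → ℝ) :=
  {x | ∀ γ, x γ ∈ Set.Icc a b}

/-- The uniform pseudometric `d_Δ(x,y) = sup {|x_γ - y_γ| : γ ∈ Δ}`, used for points of a cube,
where the supremum is over a bounded set; it is `0` for `Δ = ∅`. -/
noncomputable def unifDist {Γ : Type u} (Δ : Set Γ) (x y : Γ → ℝ) : ℝ :=
  ⨆ γ : Δ, |x γ - y γ|

/-- `𝒩_s`: the infinite sequences of natural numbers with initial segment `s`. -/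
def seqCylinder (s : List ℕ) : Set (ℕ → ℕ) :=
  {σ | ∀ (i : ℕ) (hi : i < s.length), σ i = s[i]}

/-! The implications run (1) ⇒ (2) ⇒ (3) ⇒ (1). For (1) ⇒ (2), let `f : L → K` be onto with `L` an
RN compactum with metric `d`. Continuous `d`-Lipschitz functions form an algebra that separates
points by a Urysohn lemma for lower semicontinuous metrics (`Gap.exists_continuous_lipschitz`), so
by Stone–Weierstrass they approximate each coordinate of `f` uniformly. The sequence attached to `γ`
records the Lipschitz constants of ever better approximations. Fixing one entry makes a family of
coordinates equi-Lipschitz, and fragmentability survives under such maps (`Fragments.image`). (2) ⇒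
(3) holds because there are only countably many `s` of a given length. For (3) ⇒ (1), take `ε = 2⁻ⁿ`
for all `n` and let `S` consist of the points of `K` together with all their approximants. The
approximants determine the point, so a weighted supremum of their uniform distances is a fragmenting
metric on `S`, which projects onto `K`. -/

theorem unifDist_nonneg {Γ : Type u} (Δ : Set Γ) (x y : Γ → ℝ) : 0 ≤ unifDist Δ x y :=
  Real.iSup_nonneg fun _ => abs_nonneg _

theorem unifDist_le {Γ : Type u} {Δ : Set Γ} {x y : Γ → ℝ} {c : ℝ} (hc : 0 ≤ c)
    (h : ∀ γ ∈ Δ, |x γ - y γ| ≤ c) : unifDist Δ x y ≤ c :=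
  Real.iSup_le (fun γ => h γ γ.2) hc

theorem abs_sub_le_unifDist {Γ : Type u} {a b : ℝ} {Δ : Set Γ} {x y : Γ → ℝ}
    (hx : x ∈ cube Γ a b) (hy : y ∈ cube Γ a b) {γ : Γ} (hγ : γ ∈ Δ) :
    |x γ - y γ| ≤ unifDist Δ x y := by
  refine le_ciSup (f := fun γ : Δ => |x γ - y γ|) ⟨b - a, ?_⟩ ⟨γ, hγ⟩
  rintro _ ⟨δ, rfl⟩
  have := hx δ; have := hy δ
  simp only [Set.mem_Icc] at *
  exact abs_le.2 ⟨by linarith, by linarith⟩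

theorem fragments_empty {X : Type u} [TopologicalSpace X] (d : X → X → ℝ) :
    Fragments d ∅ :=
  fun _ _ _ hL hne => ((Set.subset_empty_iff.1 hL ▸ hne).ne_empty rfl).elim

/-! ### Fragmentability of continuous images -/

/-- A closed set onto whose image a continuous map covers `B`, minimal with that property. -/
theorem exists_minimal_closed_cover {X : Type u} {Y : Type v} [TopologicalSpace X] [T2Space X]
    [TopologicalSpace Y] [T2Space Y] {A : Set X} (hA : IsCompact A) {Φ : X → Y}
    (hΦ : Continuous Φ) {B : Set Y} (hB : B ⊆ Φ '' A) :
    ∃ M ⊆ A, IsClosed M ∧ B ⊆ Φ '' M ∧ ∀ N ⊆ M, IsClosed N → B ⊆ Φ '' N → M ⊆ N := by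
  obtain ⟨M, -, hM⟩ := zorn_superset_nonempty {M : Set X | IsClosed M ∧ M ⊆ A ∧ B ⊆ Φ '' M}
    (fun c hc hch hne => by
      refine ⟨⋂₀ c, ⟨isClosed_sInter fun s hs => (hc hs).1,
        fun x hx => (hc hne.some_mem).2.1 (hx _ hne.some_mem), fun y hy => ?_⟩,
        fun s hs => Set.sInter_subset_of_mem hs⟩
      have : Nonempty c := hne.to_subtype
      -- The fibres over `y` form a chain of nonempty compact sets, so they have a common point.
      have key : (⋂ s : c, ((s : Set X) ∩ Φ ⁻¹' {y})).Nonempty := by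
        refine IsCompact.nonempty_iInter_of_directed_nonempty_isCompact_isClosed _ ?_ ?_ ?_ ?_
        · intro s t
          rcases hch.total s.2 t.2 with h | h
          · exact ⟨s, subset_rfl, Set.inter_subset_inter_left _ h⟩
          · exact ⟨t, Set.inter_subset_inter_left _ h, subset_rfl⟩
        · intro s
          obtain ⟨x, hx, hxy⟩ := (hc s.2).2.2 hy
          exact ⟨x, hx, hxy⟩
        · intro s
          exact hA.of_isClosed_subset ((hc s.2).1.inter (isClosed_singleton.preimage hΦ))
            (Set.inter_subset_left.trans (hc s.2).2.1)
        · intro s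
          exact (hc s.2).1.inter (isClosed_singleton.preimage hΦ)
      obtain ⟨x, hx⟩ := key
      rw [Set.mem_iInter] at hx
      exact ⟨x, fun s hs => (hx ⟨s, hs⟩).1, (hx ⟨_, hne.some_mem⟩).2⟩)
    A ⟨hA.isClosed, subset_rfl, hB⟩
  refine ⟨M, hM.prop.2.1, hM.prop.1, hM.prop.2.2, fun N hN hNc hBN => ?_⟩
  exact hM.le_of_le ⟨hNc, hN.trans hM.prop.2.1, hBN⟩ hN

/-- Fragmentability passes to images of compact sets under continuous Lipschitz maps. -/
theorem Fragments.image {X : Type u} {Y : Type v} [TopologicalSpace X] [T2Space X]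
    [TopologicalSpace Y] [T2Space Y] {A : Set X} (hA : IsCompact A) {Φ : X → Y}
    (hΦ : Continuous Φ) {d : X → X → ℝ} {e : Y → Y → ℝ} {C : ℝ} (hC : 0 < C)
    (h : ∀ x ∈ A, ∀ y ∈ A, e (Φ x) (Φ y) ≤ C * d x y) (hd : Fragments d A) :
    Fragments e (Φ '' A) := by
  intro ε hε L hL hne
  have hB : closure L ⊆ Φ '' A := (hA.image hΦ).isClosed.closure_subset_iff.2 hL
  obtain ⟨M, hMA, hMc, hBM, hmin⟩ := exists_minimal_closed_cover hA hΦ hB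
  have hMne : M.Nonempty := by
    obtain ⟨x, hx, -⟩ := hBM (subset_closure hne.some_mem)
    exact ⟨x, hx⟩
  obtain ⟨V, hV, ⟨x₀, hx₀⟩, δ, hδ, hVd⟩ := hd (ε / C) (by positivity) M hMA hMne
  have hcl : IsClosed (Φ '' (M \ V)) := ((hA.of_isClosed_subset (hMc.sdiff hV)
    (Set.sdiff_subset.trans hMA)).image hΦ).isClosed
  -- By minimality `M \ V` no longer covers `closure L`, so this open set meets `L`. Its points in
  -- `L` have preimages in `M`, necessarily inside the small set `V`.
  refine ⟨(Φ '' (M \ V))ᶜ, hcl.isOpen_compl, ?_, C * δ, ?_, ?_⟩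
  · have : ¬ closure L ⊆ Φ '' (M \ V) := fun hsub =>
      (hmin _ Set.sdiff_subset (hMc.sdiff hV) hsub hx₀.2).2 hx₀.1
    obtain ⟨y, hy, hy'⟩ := Set.not_subset.1 this
    exact mem_closure_iff.1 hy _ hcl.isOpen_compl hy'
  · rw [lt_div_iff₀ hC] at hδ
    linarith
  · have lift : ∀ y ∈ (Φ '' (M \ V))ᶜ ∩ L, ∃ x ∈ V ∩ M, Φ x = y := by
      rintro y ⟨hy, hyL⟩
      obtain ⟨x, hx, rfl⟩ := hBM (subset_closure hyL)
      refine ⟨x, ⟨?_, hx⟩, rfl⟩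
      by_contra hxV
      exact hy ⟨x, ⟨hx, hxV⟩, rfl⟩
    intro p hp q hq
    obtain ⟨x, hx, rfl⟩ := lift p hp
    obtain ⟨y, hy, rfl⟩ := lift q hq
    exact (h x (hMA hx.2) y (hMA hy.2)).trans
      (mul_le_mul_of_nonneg_left (hVd x hx y hy) hC.le)

/-! ### Urysohn's lemma for lower semicontinuous metrics -/

namespace IsMetric

variable {X : Type u} {d : X → X → ℝ}

theorem self_eq_zero (hd : IsMetric d) (x : X) : d x x = 0 := (hd.eq_zero_iff x x).2 rfl

theorem nonneg (hd : IsMetric d) (x y : X) : 0 ≤ d x y := by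
  have h := hd.triangle x y x
  rw [hd.self_eq_zero, hd.symm y x] at h
  linarith

end IsMetric

/-- A closed set `C` and an open set `U` such that points of `C` have `d`-distance greater than
`r` from points outside `U`. -/
structure Gap {X : Type u} [TopologicalSpace X] (d : X → X → ℝ) where
  C : Set X
  U : Set X
  r : ℝ
  isClosed : IsClosed C
  isOpen : IsOpen U
  r_pos : 0 < r
  lt_dist : ∀ x ∈ C, ∀ y ∉ U, r < d x y

/-- Lower semicontinuity closes the relation `d x y ≤ r`; projecting along a compact factor keeps it
closed. -/
theorem isClosed_thickening {X : Type u} [TopologicalSpace X] [CompactSpace X]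
    {d : X → X → ℝ} (hlsc : LowerSemicontinuous fun p : X × X => d p.1 p.2) {F : Set X}
    (hF : IsClosed F) (r : ℝ) : IsClosed {y | ∃ x ∈ F, d x y ≤ r} := by
  have h : IsClosed {p : X × X | p.1 ∈ F ∧ d p.1 p.2 ≤ r} :=
    (hF.preimage continuous_fst).inter (hlsc.isClosed_preimage r)
  convert isClosedMap_snd_of_compactSpace _ h using 1
  ext y
  simp

/-- By the triangle inequality the `r/2`-thickenings of `C` and of the complement of `U` are
disjoint. Normality puts an open `V` between them, and either side of `V` is a gap of half the
width. -/
theorem Gap.exists_split {X : Type u} [TopologicalSpace X] [CompactSpace X] [T2Space X]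
    {d : X → X → ℝ} (hd : IsMetric d) (hlsc : LowerSemicontinuous fun p : X × X => d p.1 p.2)
    (c : Gap d) : ∃ l r : Gap d, l.C = c.C ∧ r.C = closure l.U ∧ r.U = c.U ∧
      l.r = c.r / 2 ∧ r.r = c.r / 2 := by
  have hC := isClosed_thickening hlsc c.isClosed (c.r / 2)
  have hU := isClosed_thickening hlsc c.isOpen.isClosed_compl (c.r / 2)
  obtain ⟨V, hV, hCV, hVU⟩ := normal_exists_closure_subset hC hU.isOpen_compl (by
    rintro z ⟨x, hx, hxz⟩ ⟨y, hy, hyz⟩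
    have h1 := c.lt_dist x hx y hy
    have h2 := hd.triangle x z y
    rw [hd.symm z y] at h2
    linarith)
  have hr := c.r_pos
  refine ⟨⟨c.C, V, c.r / 2, c.isClosed, hV, half_pos hr, fun x hx y hy => ?_⟩,
    ⟨closure V, c.U, c.r / 2, isClosed_closure, c.isOpen, half_pos hr, fun x hx y hy => ?_⟩,
    rfl, rfl, rfl, rfl, rfl⟩
  · by_contra! h
    exact hy (hCV ⟨x, hx, h⟩)
  · by_contra! h
    exact hVU hx ⟨y, hy, by rwa [hd.symm]⟩

theorem Gap.subset {X : Type u} [TopologicalSpace X] {d : X → X → ℝ} (hd : IsMetric d) (c : Gap d) : c.C ⊆ c.U := by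
  intro x hx
  by_contra h
  have := c.lt_dist x hx x h
  rw [hd.self_eq_zero] at this
  exact absurd c.r_pos this.not_gt

/-- The binary expansion that descends through nested gaps towards a point satisfies the
recursion of Urysohn's function. -/
theorem exists_dyadic_function {T : Type u} {X : Type v} (l r : T → T) (V : T → Set X) :
    ∃ h : T → X → ℝ, (∀ c x, 0 ≤ h c x) ∧ (∀ c x, h c x ≤ 1) ∧
      (∀ c, ∀ x ∈ V c, h c x = h (l c) x / 2) ∧
      (∀ c, ∀ x ∉ V c, h c x = (1 + h (r c) x) / 2) := by
  classical
  let next : X → T → T := fun x c => if x ∈ V c then l c else r c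
  let digit : X → T → ℝ := fun x c => if x ∈ V c then 0 else 1
  let term : T → X → ℕ → ℝ := fun c x n => digit x ((next x)^[n] c) * (1 / 2 / 2 ^ n)
  have hdig : ∀ x c, 0 ≤ digit x c ∧ digit x c ≤ 1 := by
    intro x c
    by_cases hx : x ∈ V c <;> simp [digit, hx]
  have hgeo : HasSum (fun n : ℕ => (1 : ℝ) / 2 / 2 ^ n) 1 := hasSum_geometric_two' 1
  have h0 : ∀ c x n, 0 ≤ term c x n := fun c x n => mul_nonneg (hdig _ _).1 (by positivity)
  have h1 : ∀ c x n, term c x n ≤ 1 / 2 / 2 ^ n := fun c x n =>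
    mul_le_of_le_one_left (by positivity) (hdig _ _).2
  have hs : ∀ c x, Summable (term c x) := fun c x =>
    Summable.of_nonneg_of_le (h0 c x) (h1 c x) hgeo.summable
  have hrec : ∀ c x, ∑' n, term c x n = (digit x c + ∑' n, term (next x c) x n) / 2 := by
    intro c x
    rw [(hs c x).tsum_eq_zero_add, add_div, ← tsum_div_const]
    congr 1
    · simp [term]
      ring
    · refine tsum_congr fun n => ?_
      simp only [term, Function.iterate_succ_apply, pow_succ]
      ring
  refine ⟨fun c x => ∑' n, term c x n, fun c x => tsum_nonneg (h0 c x), fun c x => ?_, ?_, ?_⟩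
  · exact ((hs c x).tsum_le_tsum (h1 c x) hgeo.summable).trans hgeo.tsum_eq.le
  · intro c x hx
    simp only [hrec c x]
    simp [next, digit, hx]
  · intro c x hx
    simp only [hrec c x]
    simp [next, digit, hx]

/-- Urysohn's lemma for lower semicontinuous metrics: a gap is bridged by a continuous
Lipschitz function. -/
theorem Gap.exists_continuous_lipschitz {X : Type u} [TopologicalSpace X] [CompactSpace X]
    [T2Space X] {d : X → X → ℝ} (hd : IsMetric d)
    (hlsc : LowerSemicontinuous fun p : X × X => d p.1 p.2) (c : Gap d) :
    ∃ f : X → ℝ, Continuous f ∧ (∀ x ∈ c.C, f x = 0) ∧ (∀ x ∉ c.U, f x = 1) ∧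
      ∀ x y, |f x - f y| ≤ 4 / c.r * d x y := by
  choose l r hlC hrC hrU hl hr using fun c : Gap d => c.exists_split hd hlsc
  obtain ⟨h, h0, h1, hin, hout⟩ := exists_dyadic_function l r fun c => (l c).U
  have hCV : ∀ c : Gap d, c.C ⊆ (l c).U := fun c => hlC c ▸ (l c).subset hd
  have hVU : ∀ c : Gap d, closure (l c).U ⊆ c.U := fun c => by
    rw [← hrC, ← hrU c]; exact (r c).subset hd
  have hVU' : ∀ c : Gap d, (l c).U ⊆ c.U := fun c => subset_closure.trans (hVU c)
  have hp : ∀ n : ℕ, (1 / 2 : ℝ) ^ (n + 1) = (1 / 2) ^ n / 2 := fun n => by ring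
  have hpos : ∀ n : ℕ, (0 : ℝ) < (1 / 2) ^ n := fun n => by positivity
  have nearC : ∀ n (c : Gap d), ∀ x ∈ c.C, ∀ᶠ y in nhds x, h c y ≤ (1 / 2) ^ n := by
    intro n
    induction n with
    | zero => intro c x _; simpa using Filter.Eventually.of_forall (h1 c)
    | succ n ih =>
      intro c x hx
      filter_upwards [(l c).isOpen.mem_nhds (hCV c hx), ih (l c) x (hlC c ▸ hx)] with y hy hy'
      rw [hin c y hy, hp]
      linarith
  have nearU : ∀ n (c : Gap d), ∀ x ∉ c.U, ∀ᶠ y in nhds x, 1 - h c y ≤ (1 / 2) ^ n := by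
    intro n
    induction n with
    | zero => intro c x _; simpa using Filter.Eventually.of_forall (h0 c)
    | succ n ih =>
      intro c x hx
      filter_upwards [isClosed_closure.isOpen_compl.mem_nhds fun hx' => hx (hVU c hx'),
        ih (r c) x (by rwa [hrU c])] with y hy hy'
      rw [hout c y fun h => hy (subset_closure h), hp]
      linarith
  have eqC : ∀ (c : Gap d), ∀ x ∈ c.C, h c x = 0 := fun c x hx =>
    le_antisymm (ge_of_tendsto' (tendsto_pow_atTop_nhds_zero_of_lt_one (r := (1 / 2 : ℝ))
      (by norm_num) (by norm_num)) fun n => (nearC n c x hx).self_of_nhds) (h0 c x)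
  have eqU : ∀ (c : Gap d), ∀ x ∉ c.U, h c x = 1 := fun c x hx =>
    le_antisymm (h1 c x) (sub_nonpos.1 (ge_of_tendsto' (tendsto_pow_atTop_nhds_zero_of_lt_one
      (r := (1 / 2 : ℝ)) (by norm_num) (by norm_num)) fun n => (nearU n c x hx).self_of_nhds))
  -- On the boundary of the middle set both branches of the recursion tend to `1/2`, which is the
  -- only delicate case of continuity.
  have near : ∀ n (c : Gap d) x, ∀ᶠ y in nhds x, |h c y - h c x| ≤ (1 / 2) ^ n := by
    intro n
    induction n with
    | zero =>
      intro c x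
      refine Filter.Eventually.of_forall fun y => ?_
      have := h0 c x; have := h1 c x; have := h0 c y; have := h1 c y
      rw [abs_le]; constructor <;> norm_num <;> linarith
    | succ n ih =>
      intro c x
      by_cases hx : x ∈ (l c).U
      · filter_upwards [(l c).isOpen.mem_nhds hx, ih (l c) x] with y hy hy'
        rw [hin c y hy, hin c x hx, hp]
        rw [abs_le] at *
        constructor <;> linarith
      by_cases hx' : x ∈ closure (l c).U
      · have hx0 : h (r c) x = 0 := eqC _ _ (hrC c ▸ hx')
        filter_upwards [nearC n (r c) x (hrC c ▸ hx'), nearU n (l c) x hx] with y hy hy'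
        have := h0 (r c) y; have := h1 (l c) y; have := hpos n
        rw [hout c x hx, hx0, hp, abs_le]
        by_cases hyV : y ∈ (l c).U
        · rw [hin c y hyV]; constructor <;> linarith
        · rw [hout c y hyV]; constructor <;> linarith
      · filter_upwards [isClosed_closure.isOpen_compl.mem_nhds hx', ih (r c) x] with y hy hy'
        rw [hout c y fun h => hy (subset_closure h), hout c x hx, hp]
        rw [abs_le] at *
        constructor <;> linarith
  -- Halving a gap doubles the Lipschitz bound, while the recursion halves the function: the two
  -- cancel.
  have scale : ∀ (c : Gap d) (k t : ℝ), k / (c.r / 2) * t = 2 * (k / c.r * t) := fun c k t => by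
    have := c.r_pos.ne'
    field_simp
  have far : ∀ (c : Gap d) (t : ℝ), c.r / 2 < t → 1 ≤ 2 / c.r * t := fun c t ht => by
    have := c.r_pos
    rw [div_mul_eq_mul_div, le_div_iff₀ this]
    linarith
  have lipC : ∀ n (c : Gap d), ∀ x ∈ c.C, ∀ y, h c y ≤ 2 / c.r * d x y + (1 / 2) ^ n := by
    intro n
    induction n with
    | zero =>
      intro c x _ y
      have := c.r_pos; have := hd.nonneg x y; have := h1 c y
      have : 0 ≤ 2 / c.r * d x y := by positivity
      norm_num; linarith
    | succ n ih =>
      intro c x hx y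
      have := hpos n
      by_cases hy : y ∈ (l c).U
      · have := ih (l c) x (hlC c ▸ hx) y
        rw [hl, scale] at this
        rw [hin c y hy, hp]; linarith
      · have h2 := (l c).lt_dist x (hlC c ▸ hx) y hy
        rw [hl] at h2
        have := far c _ h2; have := h1 c y
        rw [hp]; linarith
  have lipU : ∀ n (c : Gap d), ∀ x ∉ c.U, ∀ y, 1 - h c y ≤ 2 / c.r * d y x + (1 / 2) ^ n := by
    intro n
    induction n with
    | zero =>
      intro c x _ y
      have := c.r_pos; have := hd.nonneg y x; have := h0 c y
      have : 0 ≤ 2 / c.r * d y x := by positivity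
      norm_num; linarith
    | succ n ih =>
      intro c x hx y
      have := hpos n
      by_cases hy : y ∈ (l c).U
      · have h2 := (r c).lt_dist y (hrC c ▸ subset_closure hy) x (by rwa [hrU c])
        rw [hr] at h2
        have := far c _ h2; have := h0 c y
        rw [hp]; linarith
      · have := ih (r c) x (by rwa [hrU c]) y
        rw [hr, scale] at this
        rw [hout c y hy, hp]; linarith
  -- Across the middle set the difference is `(1 - h (l c) x) / 2 + h (r c) y / 2`. Each term
  -- contributes `2 / c.r * d x y`, whence the constant `4`.
  have mixed : ∀ n (c : Gap d), ∀ x ∈ (l c).U, ∀ y ∉ (l c).U,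
      h c x ≤ h c y ∧ h c y - h c x ≤ 4 / c.r * d x y + 2 * (1 / 2) ^ (n + 1) := by
    intro n c x hx y hy
    have e1 := lipC n (r c) x (hrC c ▸ subset_closure hx) y
    have e2 := lipU n (l c) y hy x
    rw [hr, scale] at e1
    rw [hl, scale] at e2
    have e3 : 4 / c.r * d x y = 2 * (2 / c.r * d x y) := by ring
    have := h1 (l c) x; have := h0 (r c) y
    rw [hin c x hx, hout c y hy, hp, e3]
    constructor <;> linarith
  have lip : ∀ n (c : Gap d) x y, |h c x - h c y| ≤ 4 / c.r * d x y + 2 * (1 / 2) ^ n := by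
    intro n
    induction n with
    | zero =>
      intro c x y
      have := c.r_pos; have := hd.nonneg x y
      have := h0 c x; have := h1 c x; have := h0 c y; have := h1 c y
      have : 0 ≤ 4 / c.r * d x y := by positivity
      rw [abs_le]; constructor <;> norm_num <;> linarith
    | succ n ih =>
      intro c x y
      by_cases hx : x ∈ (l c).U <;> by_cases hy : y ∈ (l c).U
      · have := ih (l c) x y
        rw [hl, scale] at this
        rw [hin c x hx, hin c y hy, hp, abs_le]
        rw [abs_le] at this
        constructor <;> linarith
      · obtain ⟨e1, e2⟩ := mixed n c x hx y hy
        rw [abs_sub_comm, abs_of_nonneg (by linarith)]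
        exact e2
      · obtain ⟨e1, e2⟩ := mixed n c y hy x hx
        rw [abs_of_nonneg (by linarith), hd.symm]
        exact e2
      · have := ih (r c) x y
        rw [hr, scale] at this
        rw [hout c x hx, hout c y hy, hp, abs_le]
        rw [abs_le] at this
        constructor <;> linarith
  refine ⟨h c, continuous_iff_continuousAt.2 fun x => Metric.tendsto_nhds.2 fun ε hε => ?_,
    eqC c, eqU c, fun x y => ?_⟩
  · obtain ⟨n, hn⟩ := exists_pow_lt_of_lt_one hε (by norm_num : (1 / 2 : ℝ) < 1)
    filter_upwards [near n c x] with y hy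
    exact hy.trans_lt hn
  · have ht : Filter.Tendsto (fun n : ℕ => 4 / c.r * d x y + 2 * (1 / 2 : ℝ) ^ n) Filter.atTop
        (nhds (4 / c.r * d x y + 2 * 0)) :=
      ((tendsto_pow_atTop_nhds_zero_of_lt_one (by norm_num) (by norm_num)).const_mul 2).const_add _
    simpa using ge_of_tendsto' ht fun n => lip n c x y

/-! ### Uniform approximation by Lipschitz functions -/

/-- The algebra of continuous functions that are Lipschitz for the metric `d`. -/
def lipschitzSubalgebra {X : Type u} [TopologicalSpace X] [CompactSpace X]
    (d : X → X → ℝ) : Subalgebra ℝ C(X, ℝ) where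
  carrier := {f | ∃ C, ∀ x y, |f x - f y| ≤ C * d x y}
  mul_mem' := by
    rintro f g ⟨C, hC⟩ ⟨D, hD⟩
    refine ⟨‖g‖ * C + ‖f‖ * D, fun x y => ?_⟩
    have e : (f * g) x - (f * g) y = g x * (f x - f y) + f y * (g x - g y) := by
      simp only [ContinuousMap.mul_apply]; ring
    rw [e]
    refine (abs_add_le _ _).trans ?_
    rw [abs_mul, abs_mul, add_mul, mul_assoc, mul_assoc]
    exact add_le_add
      (mul_le_mul (g.norm_coe_le_norm x) (hC x y) (abs_nonneg _) (norm_nonneg _))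
      (mul_le_mul (f.norm_coe_le_norm y) (hD x y) (abs_nonneg _) (norm_nonneg _))
  add_mem' := by
    rintro f g ⟨C, hC⟩ ⟨D, hD⟩
    refine ⟨C + D, fun x y => ?_⟩
    have e : (f + g) x - (f + g) y = (f x - f y) + (g x - g y) := by
      simp only [ContinuousMap.add_apply]; ring
    rw [e, add_mul]
    exact (abs_add_le _ _).trans (add_le_add (hC x y) (hD x y))
  algebraMap_mem' := fun t => ⟨0, fun x y => by simp⟩

/-- Stone–Weierstrass, followed by clamping to `[a,b]`, which is 1-Lipschitz and fixes `g`. The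
constant is rounded up to a natural number so that it can serve as an entry of a sequence. -/
theorem exists_lipschitz_near {X : Type u} [TopologicalSpace X] [CompactSpace X] [T2Space X]
    {d : X → X → ℝ} (hd : IsMetric d) (hlsc : LowerSemicontinuous fun p : X × X => d p.1 p.2)
    {a b : ℝ} {g : X → ℝ} (hg : Continuous g) (hgab : ∀ x, g x ∈ Set.Icc a b) {ε : ℝ}
    (hε : 0 < ε) : ∃ f : X → ℝ, Continuous f ∧ (∀ x, f x ∈ Set.Icc a b) ∧
      (∀ x, |g x - f x| ≤ ε) ∧ ∃ C : ℕ, ∀ x y, |f x - f y| ≤ C * d x y := by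
  rcases isEmpty_or_nonempty X with hX | ⟨⟨x₀⟩⟩
  · exact ⟨g, hg, hgab, fun x => hX.elim x, 0, fun x => hX.elim x⟩
  have hab : a ≤ b := (hgab x₀).1.trans (hgab x₀).2
  have hsep : (lipschitzSubalgebra d).SeparatesPoints := by
    intro x y hxy
    have hpos : 0 < d x y := lt_of_le_of_ne (hd.nonneg x y)
      fun h => hxy ((hd.eq_zero_iff x y).1 h.symm)
    obtain ⟨f, hf, hfx, hfy, hL⟩ := Gap.exists_continuous_lipschitz hd hlsc
      ⟨{x}, {y}ᶜ, d x y / 2, isClosed_singleton, isOpen_compl_singleton, half_pos hpos, by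
        rintro _ rfl z hz
        rw [Set.mem_compl_iff, not_not] at hz
        rw [Set.mem_singleton_iff.1 hz]
        exact half_lt_self hpos⟩
    refine ⟨f, ⟨⟨f, hf⟩, ⟨_, hL⟩, rfl⟩, ?_⟩
    rw [hfx x rfl, hfy y (by simp)]
    exact zero_ne_one
  obtain ⟨⟨f, C, hC⟩, hf⟩ :=
    ContinuousMap.exists_mem_subalgebra_near_continuousMap_of_separatesPoints _ hsep ⟨g, hg⟩ ε hε
  have clamp : ∀ s t : ℝ, |max a (min b s) - max a (min b t)| ≤ |s - t| := fun s t => by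
    refine (abs_max_sub_max_le_max _ _ _ _).trans ?_
    rw [sub_self, abs_zero, max_eq_right (abs_nonneg _)]
    refine (abs_min_sub_min_le_max _ _ _ _).trans ?_
    rw [sub_self, abs_zero, max_eq_right (abs_nonneg _)]
  obtain ⟨N, hN⟩ := exists_nat_ge C
  refine ⟨fun x => max a (min b (f x)), by fun_prop, fun x => ⟨le_max_left _ _,
    max_le hab (min_le_left _ _)⟩, fun x => ?_, N, fun x y => ?_⟩
  · have h1 : g x = max a (min b (g x)) := by
      rw [min_eq_right (hgab x).2, max_eq_right (hgab x).1]
    rw [h1]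
    refine (clamp _ _).trans ?_
    have := (f - ⟨g, hg⟩).norm_coe_le_norm x
    rw [abs_sub_comm]
    exact this.trans hf.le
  · exact (clamp _ _).trans ((hC x y).trans
      (mul_le_mul_of_nonneg_right hN (hd.nonneg x y)))

/-! ### From RN images to decompositions of the index set -/

theorem IsContinuousImageOfRN.exists_cylinder_approximation {Γ : Type u} {a b : ℝ}
    {K : Set (Γ → ℝ)} (hKab : K ⊆ cube Γ a b) (h : IsContinuousImageOfRN.{u, v} K) :
    ∃ (w : Γ → (ℕ → ℕ)) (Ks : List ℕ → Set (Γ → ℝ)),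
      (∀ s, IsCompact (Ks s) ∧ Ks s ⊆ cube Γ a b) ∧
      (∀ s, Fragments (unifDist (w ⁻¹' seqCylinder s)) (Ks s)) ∧
      (∀ s, 0 < s.length → ∀ x ∈ K, ∃ y ∈ Ks s,
        unifDist (w ⁻¹' seqCylinder s) x y ≤ 1 / 2 ^ s.length) := by
  obtain ⟨L, _, f, ⟨_, _, d, hd, hlsc, hfr⟩, hf, rfl⟩ := h
  choose g hgc hgab hgf w hw using fun (γ : Γ) (n : ℕ) => exists_lipschitz_near hd hlsc
    ((continuous_apply γ).comp hf) (fun x => hKab ⟨x, rfl⟩ γ)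
    (ε := 1 / 2 ^ (n + 1)) (by positivity)
  have hgc' : ∀ n, Continuous fun x γ => g γ n x := fun n => continuous_pi fun γ => hgc γ n
  classical
  -- Only the last entry of `s` matters: it bounds the Lipschitz constants of the approximations of
  -- accuracy `2^(-length s)`. For empty `s` nothing is to be approximated, so `∅` will do.
  refine ⟨w, fun s => if 0 < s.length then (fun x γ => g γ (s.length - 1) x) '' Set.univ else ∅,
    fun s => ?_, fun s => ?_, fun s hs => ?_⟩
  · dsimp only
    split_ifs
    · refine ⟨isCompact_univ.image (hgc' _), ?_⟩
      rintro _ ⟨x, -, rfl⟩ γ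
      exact hgab γ _ x
    · exact ⟨isCompact_empty, Set.empty_subset _⟩
  · dsimp only
    split_ifs with hs
    -- The `+ 1` keeps the constant positive when the entry is `0`.
    · refine Fragments.image isCompact_univ (hgc' _) (C := s[s.length - 1] + 1) (by positivity)
        (fun x _ y _ => ?_) hfr
      have h0 := hd.nonneg x y
      refine unifDist_le (by positivity) fun γ hγ => (hw γ _ x y).trans ?_
      rw [hγ (s.length - 1) (by omega)]
      exact mul_le_mul_of_nonneg_right (by linarith) h0
    · exact fragments_empty _
  · rintro _ ⟨x, rfl⟩
    simp only [if_pos hs]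
    refine ⟨_, ⟨x, trivial, rfl⟩, unifDist_le (by positivity) fun γ _ => ?_⟩
    have := hgf γ (s.length - 1) x
    rwa [Nat.sub_add_cancel hs] at this

theorem exists_countable_approximation_of_cylinder {Γ : Type u} {a b : ℝ} {K : Set (Γ → ℝ)}
    (h : ∃ (w : Γ → (ℕ → ℕ)) (Ks : List ℕ → Set (Γ → ℝ)),
      (∀ s, IsCompact (Ks s) ∧ Ks s ⊆ cube Γ a b) ∧
      (∀ s, Fragments (unifDist (w ⁻¹' seqCylinder s)) (Ks s)) ∧
      (∀ s, 0 < s.length → ∀ x ∈ K, ∃ y ∈ Ks s,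
        unifDist (w ⁻¹' seqCylinder s) x y ≤ 1 / 2 ^ s.length)) (ε : ℝ) (hε : 0 < ε) :
    ∃ (Γm : ℕ → Set Γ) (Km : ℕ → Set (Γ → ℝ)),
      (⋃ m, Γm m) = Set.univ ∧
      (∀ m, IsCompact (Km m) ∧ Km m ⊆ cube Γ a b) ∧
      (∀ m, Fragments (unifDist (Γm m)) (Km m)) ∧
      (∀ m, ∀ x ∈ K, ∃ y ∈ Km m, unifDist (Γm m) x y ≤ ε) := by
  obtain ⟨w, Ks, hc, hf, hap⟩ := h
  obtain ⟨n, hn⟩ := exists_pow_lt_of_lt_one hε (by norm_num : (1 / 2 : ℝ) < 1)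
  -- Length `n + 1` is positive even if `n = 0`, as the approximation hypothesis requires.
  have : Nonempty {s : List ℕ // s.length = n + 1} := ⟨⟨List.replicate (n + 1) 0, by simp⟩⟩
  obtain ⟨e, he⟩ := exists_surjective_nat {s : List ℕ // s.length = n + 1}
  refine ⟨fun m => w ⁻¹' seqCylinder (e m), fun m => Ks (e m), ?_, fun m => hc _,
    fun m => hf _, fun m x hx => ?_⟩
  · refine Set.eq_univ_of_forall fun γ => Set.mem_iUnion.2 ?_
    obtain ⟨m, hm⟩ := he ⟨List.ofFn fun i : Fin (n + 1) => w γ i, by simp⟩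
    refine ⟨m, fun i hi => ?_⟩
    simp only [hm, List.getElem_ofFn]
  · obtain ⟨y, hy, hxy⟩ := hap (e m) (by rw [(e m).2]; omega) x hx
    refine ⟨y, hy, hxy.trans ?_⟩
    rw [(e m).2, ← one_div_pow]
    exact (pow_le_pow_of_le_one (by norm_num) (by norm_num) n.le_succ).trans hn.le

/-! ### Construction of an RN compactum over `K` -/

theorem EpsFragments.of_comp {X : Type u} {Y : Type v} [TopologicalSpace X]
    [TopologicalSpace Y] {A : Set Y} {π : X → Y} (hπ : Continuous π) {e : Y → Y → ℝ} {ε : ℝ}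
    {B : Set X} (hB : Set.MapsTo π B A) (h : EpsFragments e ε A) :
    EpsFragments (fun x y => e (π x) (π y)) ε B := by
  intro L hL hne
  obtain ⟨V, hV, ⟨_, hzV, z, hz, rfl⟩, δ, hδ, hVd⟩ :=
    h (π '' L) (Set.image_subset_iff.2 fun x hx => hB (hL hx)) (hne.image π)
  exact ⟨π ⁻¹' V, hV.preimage hπ, ⟨z, hzV, hz⟩, δ, hδ,
    fun x hx y hy => hVd _ ⟨hx.1, x, hx.2, rfl⟩ _ ⟨hy.1, y, hy.2, rfl⟩⟩

/-- Finitely many functions that each `ε`-fragment a set do so simultaneously. -/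
theorem exists_open_forall_lt_le {X : Type u} [TopologicalSpace X] {d : ℕ → X → X → ℝ} {ε : ℝ}
    {K : Set X} (h : ∀ k, EpsFragments (d k) ε K) (n : ℕ) {L : Set X} (hL : L ⊆ K)
    (hne : L.Nonempty) : ∃ V : Set X, IsOpen V ∧ (V ∩ L).Nonempty ∧
      ∀ k < n, ∀ x ∈ V ∩ L, ∀ y ∈ V ∩ L, d k x y ≤ ε := by
  induction n with
  | zero => exact ⟨Set.univ, isOpen_univ, by simpa, by simp⟩
  | succ n ih =>
    obtain ⟨V, hV, hVne, hVd⟩ := ih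
    obtain ⟨W, hW, hWne, δ, hδ, hWd⟩ := h n (V ∩ L) (Set.inter_subset_right.trans hL) hVne
    refine ⟨W ∩ V, hW.inter hV, by rwa [Set.inter_assoc], fun k hk x hx y hy => ?_⟩
    rcases Nat.lt_succ_iff_lt_or_eq.1 hk with hk | rfl
    · exact hVd k hk x ⟨hx.1.2, hx.2⟩ y ⟨hy.1.2, hy.2⟩
    · exact (hWd x ⟨hx.1.1, hx.1.2, hx.2⟩ y ⟨hy.1.1, hy.1.2, hy.2⟩).trans hδ.le

/-- A compactum with countably many continuous maps into bounded cubes that jointly separate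
points, each of which pulls the uniform metric back to a fragmenting one, is Radon–Nikodým. -/
theorem isRNCompact_of_maps {Γ : Type u} {L : Type v} [TopologicalSpace L] [CompactSpace L]
    [T2Space L] (g : ℕ → L → Γ → ℝ) (hg : ∀ k, Continuous (g k)) {M : ℝ}
    (hM : ∀ k p q γ, |g k p γ - g k q γ| ≤ M)
    (hsep : ∀ p q, (∀ k, g k p = g k q) → p = q)
    (hfr : ∀ k, Fragments (fun p q => unifDist Set.univ (g k p) (g k q)) Set.univ) :
    IsRNCompact L := by
  -- The weights make all terms with large first index uniformly small, leaving finitely many maps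
  -- to fragment. A supremum of continuous functions is lower semicontinuous.
  let t : ℕ × Γ → L → L → ℝ := fun i p q => (1 / 2) ^ i.1 * |g i.1 p i.2 - g i.1 q i.2|
  let D : L → L → ℝ := fun p q => ⨆ i, t i p q
  have hpow : ∀ n : ℕ, (0 : ℝ) < (1 / 2) ^ n := fun n => by positivity
  have htM : ∀ i p q, t i p q ≤ (1 / 2) ^ i.1 * M := fun i p q =>
    mul_le_mul_of_nonneg_left (hM _ _ _ _) (hpow _).le
  have ht0 : ∀ i p q, 0 ≤ t i p q := fun i p q => mul_nonneg (hpow _).le (abs_nonneg _)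
  have hbdd : ∀ p q, BddAbove (Set.range fun i => t i p q) := by
    refine fun p q => ⟨M, ?_⟩
    rintro _ ⟨i, rfl⟩
    refine (htM i p q).trans (mul_le_of_le_one_left ?_ (pow_le_one₀ (by norm_num) (by norm_num)))
    exact (abs_nonneg _).trans (hM i.1 p q i.2)
  have hle : ∀ i p q, t i p q ≤ D p q := fun i p q => le_ciSup (hbdd p q) i
  have hD0 : ∀ p q, 0 ≤ D p q := fun p q => Real.iSup_nonneg fun i => ht0 i p q
  refine ⟨inferInstance, inferInstance, D, ⟨fun p q => ⟨fun h => ?_, ?_⟩, fun p q => ?_,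
    fun p q s => ?_⟩, ?_, ?_⟩
  · refine hsep p q fun k => funext fun γ => ?_
    have h1 := hle (k, γ) p q
    rw [h] at h1
    have h2 : |g k p γ - g k q γ| ≤ 0 := nonpos_of_mul_nonpos_right h1 (hpow k)
    exact sub_eq_zero.1 (abs_nonpos_iff.1 h2)
  · rintro rfl
    simp [D, t]
  · simp only [D, t, abs_sub_comm]
  · refine Real.iSup_le (fun i => ?_) (add_nonneg (hD0 _ _) (hD0 _ _))
    refine le_trans ?_ (add_le_add (hle i p q) (hle i q s))
    simp only [t]
    rw [← mul_add]
    exact mul_le_mul_of_nonneg_left (abs_sub_le _ _ _) (hpow _).le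
  · refine lowerSemicontinuous_ciSup (fun p => hbdd p.1 p.2) fun i => Continuous.lowerSemicontinuous ?_
    have := (continuous_apply i.2).comp (hg i.1)
    have h1 : Continuous fun p : L × L => g i.1 p.1 i.2 := this.comp continuous_fst
    have h2 : Continuous fun p : L × L => g i.1 p.2 i.2 := this.comp continuous_snd
    exact continuous_const.mul (h1.sub h2).abs
  · intro ε hε A hA hne
    have hlim : Filter.Tendsto (fun n : ℕ => (1 / 2 : ℝ) ^ n * |M|) Filter.atTop (nhds (0 * |M|)) :=
      (tendsto_pow_atTop_nhds_zero_of_lt_one (by norm_num) (by norm_num)).mul_const _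
    rw [zero_mul] at hlim
    obtain ⟨n, hn⟩ := (hlim.eventually_le_const (half_pos hε)).exists
    obtain ⟨V, hV, hVne, hVd⟩ := exists_open_forall_lt_le
      (fun k => hfr k (ε / 2) (half_pos hε)) n hA hne
    refine ⟨V, hV, hVne, ε / 2, half_lt_self hε, fun p hp q hq =>
      Real.iSup_le (fun i => ?_) (half_pos hε).le⟩
    rcases lt_or_ge i.1 n with hi | hi
    · have hb : BddAbove (Set.range fun γ : (Set.univ : Set Γ) => |g i.1 p γ - g i.1 q γ|) :=
        ⟨M, by rintro _ ⟨γ, rfl⟩; exact hM _ _ _ _⟩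
      exact (mul_le_of_le_one_left (abs_nonneg _) (pow_le_one₀ (by norm_num) (by norm_num))).trans
        ((le_ciSup hb ⟨i.2, trivial⟩).trans (hVd i.1 hi p hp q hq))
    · refine (htM i p q).trans (le_trans ?_ hn)
      exact mul_le_mul (pow_le_pow_of_le_one (by norm_num) (by norm_num) hi) (le_abs_self M)
        ((abs_nonneg _).trans (hM i.1 p q i.2)) (hpow n).le

theorem continuous_indicator_pi {Γ : Type u} (Δ : Set Γ) :
    Continuous fun z : Γ → ℝ => Δ.indicator z := by
  classical
  refine continuous_pi fun γ => ?_
  by_cases hγ : γ ∈ Δ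
  · simpa [hγ] using continuous_apply γ
  · simpa [hγ] using continuous_const

theorem isContinuousImageOfRN_of_approximation {Γ : Type u} {a b : ℝ} {K : Set (Γ → ℝ)}
    (hK : IsCompact K) (hKab : K ⊆ cube Γ a b)
    (h : ∀ ε : ℝ, 0 < ε → ∃ (Γm : ℕ → Set Γ) (Km : ℕ → Set (Γ → ℝ)),
      (⋃ m, Γm m) = Set.univ ∧
      (∀ m, IsCompact (Km m) ∧ Km m ⊆ cube Γ a b) ∧
      (∀ m, Fragments (unifDist (Γm m)) (Km m)) ∧
      (∀ m, ∀ x ∈ K, ∃ y ∈ Km m, unifDist (Γm m) x y ≤ ε)) :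
    IsContinuousImageOfRN.{u, v} K := by
  choose Δ A hΔ hA hfr hap using fun n : ℕ => h ((1 / 2) ^ n) (by positivity)
  -- Setting coordinates outside `Δ` to zero turns the pseudometric on `Δ` into the full uniform
  -- distance.
  let T : ℕ × ℕ → Set (Γ → ℝ) := fun i => (fun z => (Δ i.1 i.2).indicator z) '' A i.1 i.2
  have hT : ∀ i, IsCompact (T i) := fun i => (hA _ _).1.image (continuous_indicator_pi _)
  let S : Set ((Γ → ℝ) × (ℕ × ℕ → Γ → ℝ)) := (K ×ˢ Set.univ.pi T) ∩
    {p | ∀ i, ∀ γ ∈ Δ i.1 i.2, |p.1 γ - p.2 i γ| ≤ (1 / 2) ^ i.1}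
  have hS : IsCompact S := by
    refine (hK.prod (isCompact_univ_pi hT)).inter_right ?_
    simp only [Set.ofPred_forall]
    exact isClosed_iInter fun i => isClosed_iInter fun γ => isClosed_iInter fun _ =>
      isClosed_le (by fun_prop) continuous_const
  have : CompactSpace S := isCompact_iff_compactSpace.1 hS
  have : CompactSpace (ULift.{v} S) := Homeomorph.ulift.symm.compactSpace
  have : T2Space (ULift.{v} S) := Homeomorph.ulift.symm.t2Space
  have hval : Continuous fun p : ULift.{v} S => (p.down : (Γ → ℝ) × (ℕ × ℕ → Γ → ℝ)) :=
    continuous_subtype_val.comp continuous_uliftDown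
  refine ⟨ULift.{v} S, inferInstance, fun p => p.down.1.1, ?_, continuous_fst.comp hval, ?_⟩
  · have hbound : ∀ i, ∀ x ∈ T i, ∀ y ∈ T i, ∀ γ, |x γ - y γ| ≤ |b - a| := by
      classical
      rintro i _ ⟨x, hx, rfl⟩ _ ⟨y, hy, rfl⟩ γ
      by_cases hγ : γ ∈ Δ i.1 i.2
      · have h1 := (hA _ _).2 hx γ
        have h2 := (hA _ _).2 hy γ
        simp only [Set.indicator_of_mem hγ]
        simp only [Set.mem_Icc] at h1 h2
        refine le_trans (abs_le.2 ⟨?_, ?_⟩) (le_abs_self _) <;> linarith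
      · simp [hγ]
    have hTfr : ∀ i, Fragments (unifDist Set.univ) (T i) := by
      classical
      intro i
      refine Fragments.image (hA _ _).1 (continuous_indicator_pi _) one_pos (fun x hx y hy => ?_)
        (hfr i.1 i.2)
      rw [one_mul]
      refine unifDist_le (unifDist_nonneg _ _ _) fun γ _ => ?_
      by_cases hγ : γ ∈ Δ i.1 i.2
      · simpa only [Set.indicator_of_mem hγ] using
          abs_sub_le_unifDist ((hA _ _).2 hx) ((hA _ _).2 hy) hγ
      · simpa [hγ] using unifDist_nonneg _ _ _
    have hmem : ∀ (p : ULift.{v} S) i, p.down.1.2 i ∈ T i := fun p i => p.down.2.1.2 i trivial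
    have hcont : ∀ i, Continuous fun p : ULift.{v} S => p.down.1.2 i := fun i =>
      (continuous_apply i).comp (continuous_snd.comp hval)
    refine isRNCompact_of_maps (fun k p => p.down.1.2 (Nat.unpair k)) (fun k => hcont _)
      (M := |b - a|) (fun k p q => hbound _ _ (hmem p _) _ (hmem q _)) (fun p q hpq => ?_)
      (fun k ε hε => (hTfr _ ε hε).of_comp (hcont _) fun p _ => hmem p _)
    have hy : p.down.1.2 = q.down.1.2 := funext fun i => by
      simpa using hpq (Nat.pair i.1 i.2)
    have hx : p.down.1.1 = q.down.1.1 := funext fun γ => by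
      -- At every level `n` some piece contains `γ`, and there both points are within `2⁻ⁿ` of the
      -- same approximant.
      have key : ∀ n : ℕ, |p.down.1.1 γ - q.down.1.1 γ| ≤ (1 / 2) ^ n * 2 := by
        intro n
        obtain ⟨m, hm⟩ := Set.mem_iUnion.1 ((hΔ n).symm ▸ Set.mem_univ γ)
        have h1 := p.down.2.2 (n, m) γ hm
        have h2 := q.down.2.2 (n, m) γ hm
        rw [← hy] at h2
        rw [abs_le] at *
        dsimp only at h1 h2
        constructor <;> linarith
      have hlim : Filter.Tendsto (fun n : ℕ => (1 / 2 : ℝ) ^ n * 2) Filter.atTop (nhds (0 * 2)) :=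
        (tendsto_pow_atTop_nhds_zero_of_lt_one (by norm_num) (by norm_num)).mul_const _
      have := ge_of_tendsto' hlim key
      rw [zero_mul] at this
      exact sub_eq_zero.1 (abs_nonpos_iff.1 this)
    exact ULift.ext _ _ (Subtype.ext (Prod.ext hx hy))
  · ext x
    constructor
    · rintro ⟨p, rfl⟩
      exact p.down.2.1.1
    · intro hx
      choose y hy hxy using fun i : ℕ × ℕ => hap i.1 i.2 x hx
      refine ⟨⟨⟨(x, fun i => (Δ i.1 i.2).indicator (y i)), ⟨hx, fun i _ => ⟨y i, hy i, rfl⟩⟩,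
        fun i γ hγ => ?_⟩⟩, rfl⟩
      simp only [Set.indicator_of_mem hγ]
      exact (abs_sub_le_unifDist (hKab hx) ((hA _ _).2 (hy i)) hγ).trans (hxy i)

theorem theorem3 {Γ : Type u} (a b : ℝ) (K : Set (Γ → ℝ)) (hK : IsCompact K)
    (hKab : K ⊆ cube Γ a b) :
    (IsContinuousImageOfRN.{u, v} K ↔
      ∃ (w : Γ → (ℕ → ℕ)) (Ks : List ℕ → Set (Γ → ℝ)),
        (∀ s, IsCompact (Ks s) ∧ Ks s ⊆ cube Γ a b) ∧
        (∀ s, Fragments (unifDist (w ⁻¹' seqCylinder s)) (Ks s)) ∧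
        (∀ s, 0 < s.length → ∀ x ∈ K, ∃ y ∈ Ks s,
          unifDist (w ⁻¹' seqCylinder s) x y ≤ 1 / 2 ^ s.length)) ∧
    (IsContinuousImageOfRN.{u, v} K ↔
      ∀ ε : ℝ, 0 < ε →
        ∃ (Γm : ℕ → Set Γ) (Km : ℕ → Set (Γ → ℝ)),
          (⋃ m, Γm m) = Set.univ ∧
          (∀ m, IsCompact (Km m) ∧ Km m ⊆ cube Γ a b) ∧
          (∀ m, Fragments (unifDist (Γm m)) (Km m)) ∧
          (∀ m, ∀ x ∈ K, ∃ y ∈ Km m, unifDist (Γm m) x y ≤ ε)) := by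
  have h12 := IsContinuousImageOfRN.exists_cylinder_approximation.{u, v} hKab
  have h31 := isContinuousImageOfRN_of_approximation.{u, v} hK hKab
  exact ⟨⟨h12, fun h => h31 (exists_countable_approximation_of_cylinder h)⟩,
    ⟨fun h => exists_countable_approximation_of_cylinder (h12 h), h31⟩⟩
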